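/- Let $m\ge 3$. For $u,v\in\mathbb{C}^m$ put $\langle u,v\rangle=\sum_{j=1}^m u_jv_j$ (complex bilinear). For $t,s\in\mathbb{R}^m$ put $\tau=t+is\in\mathbb{C}^m$ and $\tau^\dagger=-t+is$ (the Hermitian conjugate of the Clifford 1-vector $\tau$). Let $\mathbb{S}^{m-1}$ be the unit sphere of $\mathbb{R}^m$; for $t\in\mathbb{S}^{m-1}$ let $\mathbb{S}^{m-2}=\{s\in\mathbb{S}^{m-1}:\langle s,t\rangle=0\}$; let $dS$ denote the (unnormalized) surface measures on these spheres, and $A_n=2\pi^{n/2}/\Gamma(n/2)$. For $r\in\mathbb{N}$ and $x,y\in\mathbb{R}^m$ let \[ K_{m,r}(x,y)=\frac{2r+m-2}{m-2}\,|x|^r|y|^r\,C_r^{\frac m2-1}\!\left(\frac{\langle x,y\rangle}{|x||y|}\right) \] be the zonal spherical harmonic of degree $r$, where $C_r^{\lambda}$ is the Gegenbauer polynomial (for $x=0$ or $y=0$ the value is that of the polynomial extension: $1$ if $r=0$, and $0$ if $r\ge1$). Then there are complex constants $\theta_{j,k,\ell}$, depending only on $m,j,k,\ell$, such that for all integers $k\ge\ell\ge0$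 and all $x,y\in\mathbb{R}^m$ the following integrals converge absolutely and \[ \frac{1}{A_mA_{m-1}}\int_{\mathbb{S}^{m-1}}\int_{\mathbb{S}^{m-2}}\langle x,\tau\rangle^k\langle x,\tau^\dagger\rangle^\ell\langle y,\tau\rangle^\ell\langle y,\tau^\dagger\rangle^k\,dS(s)\,dS(t)=\sum_{j=0}^{\ell}\theta_{j,k,\ell}\,|x|^{2j}K_{m,k+\ell-2j}(x,y)\,|y|^{2j}. \] -/

import Mathlib

open MeasureTheory

noncomputable section

/-- The surface measure `dS` on the unit sphere of a finite-dimensional Euclidean space,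
induced by the Lebesgue measure of that space: it is not normalized. -/
def surfaceMeasure (E : Type*) [NormedAddCommGroup E] [InnerProductSpace ℝ E]
    [FiniteDimensional ℝ E] [MeasurableSpace E] [BorelSpace E] :
    Measure (Metric.sphere (0 : E) 1) :=
  (volume : Measure E).toSphere

/-- The area `A_m = 2 π^{m/2} / Γ(m/2)` of the unit sphere of `ℝ^m`. -/
def sphereArea (m : ℕ) : ℝ :=
  2 * Real.pi ^ ((m : ℝ) / 2) / Real.Gamma ((m : ℝ) / 2)

/-- A real vector, seen as a complex vector. -/
def complexify {m : ℕ} (x : EuclideanSpace ℝ (Fin m)) : Fin m → ℂ :=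
  fun j => (x j : ℂ)

/-- The complex bilinear (not sesquilinear) scalar product `⟨u, v⟩ = ∑ⱼ uⱼ vⱼ`. -/
def bilin {m : ℕ} (u v : Fin m → ℂ) : ℂ :=
  ∑ j, u j * v j

/-- Hermitian conjugation of the complex Clifford algebra, on `1`-vectors `u = ∑ⱼ uⱼ eⱼ`.
As `eⱼ† = -eⱼ` and scalars are conjugated, the coordinates of `u†` are `-conj uⱼ`. -/
def dagger {m : ℕ} (u : Fin m → ℂ) : Fin m → ℂ :=
  fun j => -(starRingEnd ℂ) (u j)

/-- The complex vector `τ = t + i s`. -/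
def tauVec {m : ℕ} (t s : EuclideanSpace ℝ (Fin m)) : Fin m → ℂ :=
  fun j => (t j : ℂ) + Complex.I * (s j : ℂ)

/-- The hyperplane of `ℝ^m` orthogonal to `t`. -/
abbrev orthHyperplane {m : ℕ} (t : EuclideanSpace ℝ (Fin m)) :
    Submodule ℝ (EuclideanSpace ℝ (Fin m)) :=
  (Submodule.span ℝ {t})ᗮ

/-- The unit sphere `𝕊^{m-1}` of `ℝ^m`. -/
abbrev unitSphere (m : ℕ) : Set (EuclideanSpace ℝ (Fin m)) :=
  Metric.sphere 0 1

/-- The unit sphere `𝕊^{m-2}` of the hyperplane orthogonal to `t`. -/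
abbrev orthSphere {m : ℕ} (t : EuclideanSpace ℝ (Fin m)) : Set (orthHyperplane t) :=
  Metric.sphere 0 1

/-- The inner integral `∫_{𝕊^{m-2}} F(t + i s) dS(s)` over the unit vectors `s ⟂ t`. -/
def innerIntegral {m : ℕ} (F : (Fin m → ℂ) → ℂ) (t : EuclideanSpace ℝ (Fin m)) : ℂ :=
  ∫ s : orthSphere t, F (tauVec t (s : orthHyperplane t)) ∂(surfaceMeasure (orthHyperplane t))

/-- The average `1 / (A_m A_{m-1}) ∫_{𝕊^{m-1}} ∫_{𝕊^{m-2}} F(t + i s) dS(s) dS(t)`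
over the Stiefel manifold of orthonormal pairs `(t, s)`. -/
def stiefelAverage {m : ℕ} (F : (Fin m → ℂ) → ℂ) : ℂ :=
  1 / ((sphereArea m : ℂ) * (sphereArea (m - 1) : ℂ)) *
    ∫ t : unitSphere m, innerIntegral F (t : EuclideanSpace ℝ (Fin m))
      ∂(surfaceMeasure (EuclideanSpace ℝ (Fin m)))

/-- Absolute convergence of the two integrals in `stiefelAverage F`. -/
def StiefelConverges {m : ℕ} (F : (Fin m → ℂ) → ℂ) : Prop :=
  (∀ t : unitSphere m,
    Integrable (fun s : orthSphere (t : EuclideanSpace ℝ (Fin m)) =>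
      F (tauVec t (s : orthHyperplane (t : EuclideanSpace ℝ (Fin m)))))
      (surfaceMeasure (orthHyperplane (t : EuclideanSpace ℝ (Fin m))))) ∧
  Integrable (fun t : unitSphere m => innerIntegral F (t : EuclideanSpace ℝ (Fin m)))
    (surfaceMeasure (EuclideanSpace ℝ (Fin m)))

/-- The Gegenbauer polynomial
`C_n^a(t) = ∑_{0 ≤ i ≤ n/2} (-1)^i (a)_{n-i} / (i! (n-2i)!) (2t)^{n-2i}`,
with `(a)_r = a (a+1) ⋯ (a+r-1)`. -/
def gegenbauer (n : ℕ) (a t : ℝ) : ℝ :=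
  ∑ i ∈ Finset.range (n / 2 + 1),
    (-1) ^ i * (ascPochhammer ℝ (n - i)).eval a /
      ((i.factorial : ℝ) * ((n - 2 * i).factorial : ℝ)) * (2 * t) ^ (n - 2 * i)

/-- The zonal spherical harmonic
`K_{m,k}(x, y) = (2k+m-2)/(m-2) |x|^k |y|^k C_k^{m/2-1}(⟨x, y⟩ / (|x| |y|))`.
For `x = 0` or `y = 0` the expression below is the value of this polynomial:
`1` if `k = 0` and `0` otherwise. -/
def zonalHarmonic (m k : ℕ) (x y : EuclideanSpace ℝ (Fin m)) : ℝ :=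
  (2 * (k : ℝ) + (m : ℝ) - 2) / ((m : ℝ) - 2) * ‖x‖ ^ k * ‖y‖ ^ k *
    gegenbauer k ((m : ℝ) / 2 - 1) (inner ℝ x y / (‖x‖ * ‖y‖))

/-- The integrand
`⟨x, τ⟩^k ⟨x, τ†⟩^ℓ ⟨y, τ⟩^ℓ ⟨y, τ†⟩^k` as a function of `τ`. -/
def stiefelIntegrand {m : ℕ} (k l : ℕ) (x y : EuclideanSpace ℝ (Fin m)) (τ : Fin m → ℂ) : ℂ :=
  bilin (complexify x) τ ^ k * bilin (complexify x) (dagger τ) ^ l *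
    bilin (complexify y) τ ^ l * bilin (complexify y) (dagger τ) ^ k

end

/-! Fix |y| = 1 and let P_{k,l}(x) be the mean of ⟨x,τ⟩^k ⟨x,τ†⟩^l against a weight ⟨y,τ⟩^a
⟨y,τ†⟩^b. Invariance under isometries makes P_{k,l} a polynomial in u = ⟨x,y⟩ and q = |x|²,
homogeneous of degree n = k + l in x, with coefficients independent of y
(`exists_meanPow_eq_zonalSum`). On orthonormal pairs ⟨τ,τ⟩ = ⟨τ†,τ†⟩ = 0 and ⟨τ,τ†⟩ = -2, so Δ
P_{k,l} = -4kl P_{k-1,l-1} (`laplacian_meanPow_eq`).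

A zonal polynomial is determined by its u^n coefficient and its Laplacian
(`eq_of_zonalLaplacian_eq`). The homogenized Gegenbauer polynomials H_r are harmonic, and Δ(q^{j+1}
H_r) = 2(j+1)(2r+2j+m) q^j H_r. Hence a decomposition of P_{k-1,l-1} lifts to one of P_{k,l} with a
single new term, j = 0. Induction on l, starting from the harmonic case l = 0, gives exactly j = 0,
..., l (`exists_meanPow_eq_sum_shiftedCoeff`). The exponents a, b stay free of k, l because Δ in x
does not touch the weight. Homogeneity in y removes |y| = 1 at the end. -/

noncomputable section

/-! ### Surface measures under linear isometries -/

section SphereIsometry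

variable {E F : Type*} [NormedAddCommGroup E] [InnerProductSpace ℝ E]
  [MeasurableSpace E] [BorelSpace E] [NormedAddCommGroup F]
  [InnerProductSpace ℝ F] [MeasurableSpace F] [BorelSpace F]

/-- A linear isometry equivalence, restricted to the unit spheres. -/
def sphereIsometry (e : E ≃ₗᵢ[ℝ] F) : Metric.sphere (0 : E) 1 ≃ᵐ Metric.sphere (0 : F) 1 :=
  (e.toHomeomorph.subtype (p := (· ∈ Metric.sphere (0 : E) 1))
    (q := (· ∈ Metric.sphere (0 : F) 1)) fun x => by simp).toMeasurableEquiv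

@[simp]
lemma coe_sphereIsometry (e : E ≃ₗᵢ[ℝ] F) (s : Metric.sphere (0 : E) 1) :
    (sphereIsometry e s : F) = e s := rfl

variable [FiniteDimensional ℝ E] [FiniteDimensional ℝ F]

instance : IsFiniteMeasure (surfaceMeasure E) :=
  inferInstanceAs (IsFiniteMeasure (volume : Measure E).toSphere)

-- The surface measure of a set is the dimension times the volume of the cone over it, and
-- isometries preserve both cones and volume.
open scoped Pointwise in
lemma measurePreserving_sphereIsometry (e : E ≃ₗᵢ[ℝ] F) :
    MeasurePreserving (sphereIsometry e) (surfaceMeasure E) (surfaceMeasure F) := by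
  refine ⟨(sphereIsometry e).measurable, ?_⟩
  ext s hs
  rw [(sphereIsometry e).map_apply, surfaceMeasure, surfaceMeasure,
    Measure.toSphere_apply' _ hs,
    Measure.toSphere_apply' _ ((sphereIsometry e).measurable hs),
    e.toLinearEquiv.finrank_eq]
  congr 1
  rw [← e.measurePreserving.measure_preimage_equiv (f := e.toHomeomorph.toMeasurableEquiv)]
  congr 1
  ext x
  simp only [Set.mem_smul, Set.mem_image, Set.mem_preimage]
  constructor
  · rintro ⟨r, hr, _, ⟨u, hu, rfl⟩, rfl⟩
    exact ⟨r, hr, _, ⟨_, hu, rfl⟩, by simp⟩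
  · rintro ⟨r, hr, _, ⟨u, hu, rfl⟩, h⟩
    refine ⟨r, hr, _, ⟨(sphereIsometry e).symm u, by simpa using hu, rfl⟩, e.injective ?_⟩
    rw [map_smul, ← coe_sphereIsometry, MeasurableEquiv.apply_symm_apply, h]
    rfl

lemma integral_sphereIsometry (e : E ≃ₗᵢ[ℝ] F) (f : Metric.sphere (0 : F) 1 → ℂ) :
    ∫ s, f (sphereIsometry e s) ∂surfaceMeasure E = ∫ s, f s ∂surfaceMeasure F :=
  (measurePreserving_sphereIsometry e).integral_comp' f

end SphereIsometry

/-! ### Orthonormal pairs and the invariant mean over them -/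

variable {m : ℕ}

/-- The orthonormal pairs `(t, s)` in `ℝ^m`. -/
def stiefel (m : ℕ) : Set (EuclideanSpace ℝ (Fin m) × EuclideanSpace ℝ (Fin m)) :=
  {p | ‖p.1‖ = 1 ∧ ‖p.2‖ = 1 ∧ inner ℝ p.1 p.2 = 0}

lemma isCompact_stiefel (m : ℕ) : IsCompact (stiefel m) := by
  refine ((isCompact_sphere (0 : EuclideanSpace ℝ (Fin m)) 1).prod
    (isCompact_sphere (0 : EuclideanSpace ℝ (Fin m)) 1)).of_isClosed_subset ?_ ?_
  · exact (isClosed_eq (by fun_prop) (by fun_prop)).inter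
      ((isClosed_eq (by fun_prop) (by fun_prop)).inter (isClosed_eq (by fun_prop) (by fun_prop)))
  · rintro ⟨t, s⟩ ⟨ht, hs, -⟩
    simpa using ⟨ht, hs⟩

instance : CompactSpace (stiefel m) := isCompact_iff_compactSpace.mp (isCompact_stiefel m)

/-- An isometry, acting on orthonormal pairs. -/
def stiefelMap (g : EuclideanSpace ℝ (Fin m) ≃ₗᵢ[ℝ] EuclideanSpace ℝ (Fin m)) :
    C(stiefel m, stiefel m) where
  toFun p := ⟨(g p.1.1, g p.1.2), by
    obtain ⟨⟨t, s⟩, ht, hs, hts⟩ := p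
    exact ⟨by simpa using ht, by simpa using hs, by simpa using hts⟩⟩
  continuous_toFun := by fun_prop

/-- The orthonormal pair given by a unit vector `t` and a unit vector of its orthogonal. -/
def stiefelMk (t : unitSphere m) (s : orthSphere (t : EuclideanSpace ℝ (Fin m))) : stiefel m :=
  ⟨(t, (s : orthHyperplane (t : EuclideanSpace ℝ (Fin m)))), by
    refine ⟨by simp, mem_sphere_zero_iff_norm.mp s.2, ?_⟩
    exact Submodule.mem_orthogonal_singleton_iff_inner_right.mp s.1.2⟩

/-- An isometry sending `t` to `u` induces an isometry of their orthogonal hyperplanes. -/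
def orthIsometry (g : EuclideanSpace ℝ (Fin m) ≃ₗᵢ[ℝ] EuclideanSpace ℝ (Fin m))
    {t u : EuclideanSpace ℝ (Fin m)} (h : g t = u) : orthHyperplane t ≃ₗᵢ[ℝ] orthHyperplane u where
  toFun s := ⟨g s, by
    rw [Submodule.mem_orthogonal_singleton_iff_inner_right, ← h, g.inner_map_map]
    exact Submodule.mem_orthogonal_singleton_iff_inner_right.mp s.2⟩
  invFun s := ⟨g.symm s, by
    rw [Submodule.mem_orthogonal_singleton_iff_inner_right, ← g.inner_map_map, h,
      g.apply_symm_apply]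
    exact Submodule.mem_orthogonal_singleton_iff_inner_right.mp s.2⟩
  left_inv s := by simp
  right_inv s := by simp
  map_add' s s' := by ext; simp
  map_smul' s s' := by ext; simp
  norm_map' s := by simp

/-- A rotation of `ℝ^m` that moves `e` to the unit vector `t`. -/
def moveTo (e t : EuclideanSpace ℝ (Fin m)) :
    EuclideanSpace ℝ (Fin m) ≃ₗᵢ[ℝ] EuclideanSpace ℝ (Fin m) :=
  Submodule.reflection (ℝ ∙ (e - t))ᗮ

lemma moveTo_self {e t : EuclideanSpace ℝ (Fin m)} (h : ‖e‖ = ‖t‖) : moveTo e t e = t :=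
  Submodule.reflection_sub h

lemma moveTo_apply (e t s : EuclideanSpace ℝ (Fin m)) :
    moveTo e t s = s - (2 * (inner ℝ (e - t) s / ‖e - t‖ ^ 2)) • (e - t) := by
  rw [moveTo, Submodule.reflection_orthogonal_apply, Submodule.reflection_singleton_apply]
  simp only [RCLike.ofReal_real_eq_id, id]
  module

/-- The inner integral of a continuous function on orthonormal pairs. -/
def fiberIntegral (F : C(stiefel m, ℂ)) (t : unitSphere m) : ℂ :=
  ∫ s, F (stiefelMk t s) ∂surfaceMeasure (orthHyperplane (t : EuclideanSpace ℝ (Fin m)))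

lemma continuous_stiefelMk (t : unitSphere m) : Continuous (stiefelMk t) := by
  unfold stiefelMk
  fun_prop

lemma integrable_fiber (F : C(stiefel m, ℂ)) (t : unitSphere m) :
    Integrable (fun s => F (stiefelMk t s))
      (surfaceMeasure (orthHyperplane (t : EuclideanSpace ℝ (Fin m)))) :=
  (F.continuous.comp (continuous_stiefelMk t)).integrable_of_hasCompactSupport
    (HasCompactSupport.of_compactSpace _)

lemma fiberIntegral_eq {e : EuclideanSpace ℝ (Fin m)}
    (g : EuclideanSpace ℝ (Fin m) ≃ₗᵢ[ℝ] EuclideanSpace ℝ (Fin m)) (F : C(stiefel m, ℂ))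
    (t : unitSphere m) (h : g e = t) :
    fiberIntegral F t =
      ∫ s, F (stiefelMk t (sphereIsometry (orthIsometry g h) s)) ∂surfaceMeasure (orthHyperplane e) :=
  (integral_sphereIsometry (orthIsometry g h) fun s => F (stiefelMk t s)).symm

/-- The domain of integration varies with t. The reflection taking e to t pulls it back to one fixed
sphere. This reflection need not be continuous at t = e, but its explicit formula is jointly
measurable. -/
lemma stronglyMeasurable_fiberIntegral (F : C(stiefel m, ℂ)) :
    StronglyMeasurable (fiberIntegral F) := by
  rcases isEmpty_or_nonempty (unitSphere m) with _ | ⟨⟨e, he⟩⟩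
  · exact ⟨fun _ => 0, fun t => isEmptyElim t⟩
  have he' : ‖e‖ = 1 := by simpa using he
  have h (t : unitSphere m) : moveTo e t e = t := moveTo_self (by simp [he'])
  have : fiberIntegral F = fun t => ∫ s,
      F (stiefelMk t (sphereIsometry (orthIsometry (moveTo e t) (h t)) s))
        ∂surfaceMeasure (orthHyperplane e) := by
    ext t
    exact fiberIntegral_eq _ F t (h t)
  rw [this]
  apply StronglyMeasurable.integral_prod_right
  apply F.continuous.stronglyMeasurable.comp_measurable
  apply Measurable.subtype_mk
  have : Measurable fun p : unitSphere m × orthSphere e =>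
      moveTo e p.1 ((p.2 : orthHyperplane e) : EuclideanSpace ℝ (Fin m)) := by
    simp only [moveTo_apply]
    fun_prop
  exact (measurable_subtype_coe.comp measurable_fst).prodMk this

lemma norm_fiberIntegral_le {e : EuclideanSpace ℝ (Fin m)} (he : ‖e‖ = 1)
    (F : C(stiefel m, ℂ)) (t : unitSphere m) :
    ‖fiberIntegral F t‖ ≤ ‖F‖ * (surfaceMeasure (orthHyperplane e)).real Set.univ := by
  rw [fiberIntegral_eq (moveTo e t) F t (moveTo_self (by simp [he]))]
  exact norm_integral_le_of_norm_le_const (.of_forall fun s => F.norm_coe_le_norm _)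

lemma integrable_fiberIntegral (F : C(stiefel m, ℂ)) :
    Integrable (fiberIntegral F) (surfaceMeasure (EuclideanSpace ℝ (Fin m))) := by
  rcases isEmpty_or_nonempty (unitSphere m) with _ | ⟨⟨e, he⟩⟩
  · exact Integrable.of_isEmpty
  exact .of_bound (stronglyMeasurable_fiberIntegral F).aestronglyMeasurable _
    (.of_forall (norm_fiberIntegral_le (by simpa using he) F))

/-- The average over orthonormal pairs, as a continuous linear functional. -/
def stiefelMean (m : ℕ) : C(stiefel m, ℂ) →L[ℂ] ℂ :=
  (1 / ((sphereArea m : ℂ) * (sphereArea (m - 1) : ℂ))) • LinearMap.mkContinuousOfExistsBound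
    { toFun F := ∫ t, fiberIntegral F t ∂surfaceMeasure (EuclideanSpace ℝ (Fin m))
      map_add' F G := by
        rw [← integral_add (integrable_fiberIntegral F) (integrable_fiberIntegral G)]
        congr 1 with t
        exact integral_add (integrable_fiber F t) (integrable_fiber G t)
      map_smul' c F := by
        rw [RingHom.id_apply, ← integral_smul]
        congr 1 with t
        exact integral_smul c _ } (by
    rcases isEmpty_or_nonempty (unitSphere m) with _ | ⟨⟨e, he⟩⟩
    · exact ⟨0, fun F => by simp [integral_of_isEmpty]⟩
    refine ⟨(surfaceMeasure (orthHyperplane e)).real Set.univ *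
      (surfaceMeasure (EuclideanSpace ℝ (Fin m))).real Set.univ, fun F => ?_⟩
    refine (norm_integral_le_of_norm_le_const
      (.of_forall (norm_fiberIntegral_le (by simpa using he) F))).trans_eq (by ring))

lemma stiefelMean_apply (F : C(stiefel m, ℂ)) :
    stiefelMean m F = 1 / ((sphereArea m : ℂ) * (sphereArea (m - 1) : ℂ)) *
      ∫ t, fiberIntegral F t ∂surfaceMeasure (EuclideanSpace ℝ (Fin m)) := rfl

/-- The isometry g identifies the fibre over t with the fibre over g t, and the outer measure is
invariant under g. -/
lemma stiefelMean_comp_stiefelMap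
    (g : EuclideanSpace ℝ (Fin m) ≃ₗᵢ[ℝ] EuclideanSpace ℝ (Fin m)) (F : C(stiefel m, ℂ)) :
    stiefelMean m (F.comp (stiefelMap g)) = stiefelMean m F := by
  rw [stiefelMean_apply, stiefelMean_apply, ← integral_sphereIsometry g (fiberIntegral F)]
  congr 2 with t
  exact (fiberIntegral_eq g F (sphereIsometry g t) rfl).symm

lemma stiefelAverage_eq (F : (Fin m → ℂ) → ℂ) (G : C(stiefel m, ℂ))
    (h : ∀ p : stiefel m, F (tauVec p.1.1 p.1.2) = G p) :
    StiefelConverges F ∧ stiefelAverage F = stiefelMean m G := by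
  have h1 (t : unitSphere m) (s : orthSphere (t : EuclideanSpace ℝ (Fin m))) :
      F (tauVec t (s : orthHyperplane (t : EuclideanSpace ℝ (Fin m)))) = G (stiefelMk t s) :=
    h (stiefelMk t s)
  have h2 : (fun t : unitSphere m => innerIntegral F (t : EuclideanSpace ℝ (Fin m))) =
      fiberIntegral G := by
    ext t
    simp only [innerIntegral, h1, fiberIntegral]
  refine ⟨⟨fun t => ?_, ?_⟩, ?_⟩
  · simp only [h1]
    exact integrable_fiber G t
  · rw [h2]
    exact integrable_fiberIntegral G
  · rw [stiefelAverage, h2, stiefelMean_apply]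

/-! ### The linear forms ⟨x,τ⟩ and ⟨x,τ†⟩ -/

/-- The function `⟨x, τ⟩` of the orthonormal pair `(t, s)`, where `τ = t + i s`. -/
def tauForm (m : ℕ) : EuclideanSpace ℝ (Fin m) →ₗ[ℝ] C(stiefel m, ℂ) where
  toFun x := ⟨fun p => (inner ℝ x p.1.1 : ℂ) + Complex.I * (inner ℝ x p.1.2 : ℂ), by fun_prop⟩
  map_add' x y := by
    ext p
    simp only [inner_add_left, ContinuousMap.coe_mk, ContinuousMap.add_apply]
    push_cast
    ring
  map_smul' r x := by
    ext p
    simp only [real_inner_smul_left, ContinuousMap.coe_mk, ContinuousMap.smul_apply,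
      RingHom.id_apply, Complex.real_smul]
    push_cast
    ring

/-- The function `⟨x, τ†⟩` of the orthonormal pair `(t, s)`, where `τ† = -t + i s`. -/
def daggerForm (m : ℕ) : EuclideanSpace ℝ (Fin m) →ₗ[ℝ] C(stiefel m, ℂ) where
  toFun x := ⟨fun p => -(inner ℝ x p.1.1 : ℂ) + Complex.I * (inner ℝ x p.1.2 : ℂ), by fun_prop⟩
  map_add' x y := by
    ext p
    simp only [inner_add_left, ContinuousMap.coe_mk, ContinuousMap.add_apply]
    push_cast
    ring
  map_smul' r x := by
    ext p
    simp only [real_inner_smul_left, ContinuousMap.coe_mk, ContinuousMap.smul_apply,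
      RingHom.id_apply, Complex.real_smul]
    push_cast
    ring

lemma tauForm_apply (x : EuclideanSpace ℝ (Fin m)) (p : stiefel m) :
    tauForm m x p = (inner ℝ x p.1.1 : ℂ) + Complex.I * (inner ℝ x p.1.2 : ℂ) := rfl

lemma daggerForm_apply (x : EuclideanSpace ℝ (Fin m)) (p : stiefel m) :
    daggerForm m x p = -(inner ℝ x p.1.1 : ℂ) + Complex.I * (inner ℝ x p.1.2 : ℂ) := rfl

lemma tauForm_comp_stiefelMap
    (g : EuclideanSpace ℝ (Fin m) ≃ₗᵢ[ℝ] EuclideanSpace ℝ (Fin m)) (x : EuclideanSpace ℝ (Fin m)) :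
    (tauForm m (g x)).comp (stiefelMap g) = tauForm m x := by
  ext p
  simp [tauForm_apply, stiefelMap]

lemma daggerForm_comp_stiefelMap
    (g : EuclideanSpace ℝ (Fin m) ≃ₗᵢ[ℝ] EuclideanSpace ℝ (Fin m)) (x : EuclideanSpace ℝ (Fin m)) :
    (daggerForm m (g x)).comp (stiefelMap g) = daggerForm m x := by
  ext p
  simp [daggerForm_apply, stiefelMap]

lemma bilin_complexify_tauVec (x t s : EuclideanSpace ℝ (Fin m)) :
    bilin (complexify x) (tauVec t s) = (inner ℝ x t : ℂ) + Complex.I * (inner ℝ x s : ℂ) := by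
  simp only [bilin, complexify, tauVec, PiLp.inner_apply, Complex.ofReal_sum, Finset.mul_sum,
    ← Finset.sum_add_distrib]
  refine Finset.sum_congr rfl fun j _ => ?_
  simp
  ring

lemma bilin_complexify_dagger_tauVec (x t s : EuclideanSpace ℝ (Fin m)) :
    bilin (complexify x) (dagger (tauVec t s)) =
      -(inner ℝ x t : ℂ) + Complex.I * (inner ℝ x s : ℂ) := by
  simp only [bilin, complexify, tauVec, dagger, PiLp.inner_apply, Complex.ofReal_sum,
    Finset.mul_sum, ← Finset.sum_neg_distrib, ← Finset.sum_add_distrib]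
  refine Finset.sum_congr rfl fun j _ => ?_
  simp
  ring

/-- The mean of `⟨x, τ⟩^k ⟨x, τ†⟩^l W(τ)` over orthonormal pairs. -/
def meanPow (k l : ℕ) (W : C(stiefel m, ℂ)) (x : EuclideanSpace ℝ (Fin m)) : ℂ :=
  stiefelMean m (tauForm m x ^ k * daggerForm m x ^ l * W)

/-- The weight `⟨y, τ⟩^a ⟨y, τ†⟩^b`. -/
def weight (a b : ℕ) (y : EuclideanSpace ℝ (Fin m)) : C(stiefel m, ℂ) :=
  tauForm m y ^ a * daggerForm m y ^ b

lemma meanPow_map (g : EuclideanSpace ℝ (Fin m) ≃ₗᵢ[ℝ] EuclideanSpace ℝ (Fin m))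
    (k l a b : ℕ) (x y : EuclideanSpace ℝ (Fin m)) :
    meanPow k l (weight a b (g y)) (g x) = meanPow k l (weight a b y) x := by
  rw [meanPow, meanPow, weight, weight, ← stiefelMean_comp_stiefelMap g]
  rw [← tauForm_comp_stiefelMap g x, ← tauForm_comp_stiefelMap g y,
    ← daggerForm_comp_stiefelMap g x, ← daggerForm_comp_stiefelMap g y]
  rfl

/-! ### Invariance makes the mean a zonal polynomial -/

/-- There is an isometry fixing `e` that moves `x` into the half-plane through `f`. -/
lemma exists_isometry_fix {e f : EuclideanSpace ℝ (Fin m)} (he : ‖e‖ = 1) (hf : ‖f‖ = 1)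
    (hef : inner ℝ e f = 0) (x : EuclideanSpace ℝ (Fin m)) (b : ℝ)
    (hb : b ^ 2 = ‖x‖ ^ 2 - inner ℝ x e ^ 2) :
    ∃ g : EuclideanSpace ℝ (Fin m) ≃ₗᵢ[ℝ] EuclideanSpace ℝ (Fin m),
      g e = e ∧ g x = inner ℝ x e • e + b • f := by
  set p := x - inner ℝ x e • e with hp
  have hpe : inner ℝ p e = 0 := by
    rw [hp, inner_sub_left, real_inner_smul_left, real_inner_self_eq_norm_sq, he]
    ring
  have hfe : inner ℝ f e = 0 := by rw [real_inner_comm, hef]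
  have hn : ‖p‖ = ‖b • f‖ := by
    rw [← sq_eq_sq₀ (norm_nonneg _) (norm_nonneg _), norm_smul, hf, mul_one, Real.norm_eq_abs,
      sq_abs, hb, hp, norm_sub_sq_real, norm_smul, he, real_inner_smul_right, Real.norm_eq_abs,
      mul_one, sq_abs]
    ring
  -- The reflection exchanging p and b • f fixes e, since both vectors are orthogonal to e.
  have hge : moveTo p (b • f) e = e := by
    rw [moveTo_apply, inner_sub_left, hpe, real_inner_smul_left, hfe]
    simp
  refine ⟨moveTo p (b • f), hge, ?_⟩
  calc moveTo p (b • f) x = moveTo p (b • f) (inner ℝ x e • e + p) := by rw [hp]; simp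
    _ = _ := by rw [map_add, map_smul, hge, moveTo_self hn]

lemma exists_linear_pow_mul_linear_pow {R : Type*} [CommRing R] [Algebra ℝ R] (A α B β : R)
    (k l : ℕ) : ∃ G : ℕ → R, ∀ a b : ℝ, (a • A + b • α) ^ k * (a • B + b • β) ^ l =
      ∑ p ∈ Finset.range (k + l + 1), (a ^ (k + l - p) * b ^ p) • G p := by
  have step (n : ℕ) (G : ℕ → R) (C γ : R) : ∃ G' : ℕ → R, ∀ a b : ℝ,
      (a • C + b • γ) * ∑ p ∈ Finset.range (n + 1), (a ^ (n - p) * b ^ p) • G p =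
        ∑ p ∈ Finset.range (n + 1 + 1), (a ^ (n + 1 - p) * b ^ p) • G' p := by
    -- The coefficient of a^{n+1-p} b^p collects C G_p and γ G_{p-1}; the conditions discard the
    -- missing term at either end.
    refine ⟨fun p => (if p ≤ n then C * G p else 0) + (if p = 0 then 0 else γ * G (p - 1)),
      fun a b => ?_⟩
    simp only [smul_add, Finset.sum_add_distrib, add_mul]
    congr 1
    · rw [Finset.sum_range_succ _ (n + 1), Finset.mul_sum]
      simp only [add_le_iff_nonpos_right, nonpos_iff_eq_zero, one_ne_zero, if_false, smul_zero,
        add_zero]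
      refine Finset.sum_congr rfl fun p hp => ?_
      have hp : p ≤ n := Nat.lt_succ_iff.mp (Finset.mem_range.mp hp)
      rw [if_pos hp, Nat.succ_sub hp, smul_mul_smul_comm, pow_succ]
      congr 1
      ring
    · rw [Finset.sum_range_succ' _ (n + 1), Finset.mul_sum]
      simp only [Nat.add_eq_zero_iff, one_ne_zero, and_false, if_false, if_true, smul_zero,
        add_zero, Nat.add_sub_cancel]
      refine Finset.sum_congr rfl fun p hp => ?_
      rw [Nat.add_sub_add_right, smul_mul_smul_comm]
      congr 1
      ring
  induction k with
  | zero =>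
    induction l with
    | zero => exact ⟨fun _ => 1, fun a b => by simp⟩
    | succ l ih =>
      obtain ⟨G, hG⟩ := ih
      obtain ⟨G', hG'⟩ := step (0 + l) G B β
      refine ⟨G', fun a b => ?_⟩
      rw [← add_assoc, ← hG', ← hG]
      ring
  | succ k ih =>
    obtain ⟨G, hG⟩ := ih
    obtain ⟨G', hG'⟩ := step (k + l) G A α
    refine ⟨G', fun a b => ?_⟩
    rw [add_right_comm k 1 l, ← hG', ← hG]
    ring

/-- The polynomial `∑ᵢ cᵢ u^{n-2i} q^i`. -/
def zonalSum (n : ℕ) (c : ℕ → ℂ) (u q : ℝ) : ℂ :=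
  ∑ i ∈ Finset.range (n / 2 + 1), c i * ((u ^ (n - 2 * i) * q ^ i : ℝ) : ℂ)

/-- Symmetrizing in b cancels the odd powers, so that only b² is left. -/
lemma sum_add_sum_neg_eq (n : ℕ) (C : ℕ → ℂ) (a b : ℝ) :
    ∑ p ∈ Finset.range (n + 1), ((a ^ (n - p) * b ^ p : ℝ) : ℂ) * C p +
      ∑ p ∈ Finset.range (n + 1), ((a ^ (n - p) * (-b) ^ p : ℝ) : ℂ) * C p =
    2 * ∑ i ∈ Finset.range (n / 2 + 1), ((a ^ (n - 2 * i) * (b ^ 2) ^ i : ℝ) : ℂ) * C (2 * i) := by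
  rw [← Finset.sum_add_distrib, Finset.mul_sum]
  have h : ∀ i ∈ Finset.range (n / 2 + 1), 2 * i ∈ Finset.range (n + 1) := fun i hi => by
    simp only [Finset.mem_range] at *
    omega
  refine (Finset.sum_of_injOn (2 * ·) (fun i _ j _ hij => ?_) (fun i hi => ?_)
    (fun p hp hp' => ?_) fun i hi => ?_).symm
  · simpa using hij
  · exact h i (by simpa using hi)
  · have hodd : Odd p := by
      by_contra h2
      obtain ⟨i, rfl⟩ := even_iff_exists_two_mul.mp (Nat.not_odd_iff_even.mp h2)
      refine hp' ⟨i, ?_, rfl⟩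
      simp only [Finset.mem_range, Finset.coe_range, Set.mem_Iio] at *
      omega
    rw [hodd.neg_pow]
    push_cast
    ring
  · rw [(even_two_mul i).neg_pow, pow_mul b 2 i]
    ring

lemma exists_zonalSum_of_sub (n : ℕ) (C : ℕ → ℂ) : ∃ c : ℕ → ℂ, ∀ a q : ℝ,
    ∑ i ∈ Finset.range (n / 2 + 1), ((a ^ (n - 2 * i) * (q - a ^ 2) ^ i : ℝ) : ℂ) * C i =
      zonalSum n c a q := by
  refine ⟨fun s => ∑ i ∈ Finset.range (n / 2 + 1), (-1) ^ (i - s) * (i.choose s : ℂ) * C i,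
    fun a q => ?_⟩
  simp only [zonalSum, Finset.sum_mul]
  rw [Finset.sum_comm]
  refine Finset.sum_congr rfl fun i hi => ?_
  have hi : i < n / 2 + 1 := Finset.mem_range.mp hi
  rw [sub_eq_add_neg, add_pow, Finset.mul_sum, Complex.ofReal_sum, Finset.sum_mul]
  refine Finset.sum_subset_zero_on_sdiff (Finset.range_subset_range.mpr (by omega)) ?_ ?_
  · intro s hs
    simp only [Finset.mem_sdiff, Finset.mem_range] at hs
    rw [Nat.choose_eq_zero_of_lt (by omega)]
    simp
  · intro s hs
    have hs : s < i + 1 := Finset.mem_range.mp hs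
    have : n - 2 * s = n - 2 * i + 2 * (i - s) := by omega
    rw [neg_pow (a ^ 2), ← pow_mul, this, pow_add]
    push_cast
    ring

lemma stiefelMean_real_smul (r : ℝ) (F : C(stiefel m, ℂ)) :
    stiefelMean m (r • F) = (r : ℂ) * stiefelMean m F := by
  have : r • F = (r : ℂ) • F := by
    ext p
    simp
  rw [this, map_smul, smul_eq_mul]

lemma exists_meanPow_plane (k l : ℕ) (W : C(stiefel m, ℂ)) (e f : EuclideanSpace ℝ (Fin m)) :
    ∃ M : ℕ → ℂ, ∀ u v : ℝ, meanPow k l W (u • e + v • f) =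
      ∑ p ∈ Finset.range (k + l + 1), ((u ^ (k + l - p) * v ^ p : ℝ) : ℂ) * M p := by
  obtain ⟨G, hG⟩ := exists_linear_pow_mul_linear_pow (tauForm m e) (tauForm m f)
    (daggerForm m e) (daggerForm m f) k l
  refine ⟨fun p => stiefelMean m (G p * W), fun u v => ?_⟩
  rw [meanPow, map_add, map_add, map_smul, map_smul, map_smul, map_smul, hG, Finset.sum_mul,
    map_sum]
  refine Finset.sum_congr rfl fun p _ => ?_
  rw [smul_mul_assoc, stiefelMean_real_smul]

/-- Invariance under isometries makes the mean a polynomial in `⟨x, y⟩` and `‖x‖²`. -/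
lemma exists_meanPow_eq_zonalSum (hm : 2 ≤ m) (k l a b : ℕ) : ∃ c : ℕ → ℂ,
    ∀ x y : EuclideanSpace ℝ (Fin m), ‖y‖ = 1 →
      meanPow k l (weight a b y) x = zonalSum (k + l) c (inner ℝ x y) (‖x‖ ^ 2) := by
  set e : EuclideanSpace ℝ (Fin m) := EuclideanSpace.single ⟨0, by omega⟩ 1 with he_def
  set f : EuclideanSpace ℝ (Fin m) := EuclideanSpace.single ⟨1, by omega⟩ 1 with hf_def
  have he : ‖e‖ = 1 := by simp [he_def]
  have hf : ‖f‖ = 1 := by simp [hf_def]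
  have hef : inner ℝ e f = 0 := by simp [he_def, hf_def, EuclideanSpace.inner_single_left]
  obtain ⟨M, hplane⟩ := exists_meanPow_plane k l (weight a b e) e f
  obtain ⟨c, hc⟩ := exists_zonalSum_of_sub (k + l) fun i => M (2 * i)
  refine ⟨c, fun x y hy => ?_⟩
  have hg : moveTo y e y = e := moveTo_self (by rw [hy, he])
  have hinner : inner ℝ (moveTo y e x) e = inner ℝ x y := by
    have h := (moveTo y e).inner_map_map x y
    rwa [hg] at h
  -- Both square roots v are admissible, so the polynomial in the plane of e and f takes the same
  -- value at v and -v and may be symmetrized.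
  have key (v : ℝ) (hv : v ^ 2 = ‖x‖ ^ 2 - inner ℝ x y ^ 2) :
      meanPow k l (weight a b y) x =
        meanPow k l (weight a b e) (inner ℝ x y • e + v • f) := by
    obtain ⟨g, hge, hgx⟩ := exists_isometry_fix he hf hef (moveTo y e x) v
      (by rw [hinner, LinearIsometryEquiv.norm_map, hv])
    rw [hinner] at hgx
    rw [← hgx, ← meanPow_map (moveTo y e), hg, ← meanPow_map g, hge]
  have hnonneg : 0 ≤ ‖x‖ ^ 2 - inner ℝ x y ^ 2 := by
    have := abs_real_inner_le_norm x y
    rw [hy, mul_one] at this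
    rw [sub_nonneg, ← sq_abs (inner ℝ x y)]
    gcongr
  have hsq := Real.sq_sqrt hnonneg
  have h1 := key _ hsq
  have h2 := key (-√(‖x‖ ^ 2 - inner ℝ x y ^ 2)) (by rw [neg_sq, hsq])
  rw [hplane] at h1 h2
  have h3 := sum_add_sum_neg_eq (k + l) M
    (inner ℝ x y) √(‖x‖ ^ 2 - inner ℝ x y ^ 2)
  rw [← h1, ← h2, ← two_mul, hsq, hc] at h3
  exact mul_left_cancel₀ two_ne_zero h3

/-! ### The Laplacian in x of both expressions -/

lemma meanPow_sum {ι : Type*} (s : Finset ι) (k l : ℕ) (W : ι → C(stiefel m, ℂ))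
    (x : EuclideanSpace ℝ (Fin m)) :
    ∑ i ∈ s, meanPow k l (W i) x = meanPow k l (∑ i ∈ s, W i) x := by
  simp only [meanPow, Finset.mul_sum, map_sum]

lemma meanPow_const_mul (r : ℝ) (k l : ℕ) (W : C(stiefel m, ℂ)) (x : EuclideanSpace ℝ (Fin m)) :
    meanPow k l (r • W) x = r * meanPow k l W x := by
  rw [meanPow, mul_smul_comm, stiefelMean_real_smul, meanPow]

lemma meanPow_zero (k l : ℕ) (x : EuclideanSpace ℝ (Fin m)) :
    meanPow k l (0 : C(stiefel m, ℂ)) x = 0 := by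
  rw [meanPow, mul_zero, map_zero]

/-- The forms are linear in x with values in the Banach algebra of continuous functions, and the
mean is a continuous functional on it. The product rule there replaces differentiation under the
integral. -/
lemma hasDerivAt_meanPow (k l : ℕ) (W : C(stiefel m, ℂ)) (x v : EuclideanSpace ℝ (Fin m))
    (h : ℝ) :
    HasDerivAt (fun h : ℝ => meanPow k l W (x + h • v))
      (k * meanPow (k - 1) l (tauForm m v * W) (x + h • v) +
        l * meanPow k (l - 1) (daggerForm m v * W) (x + h • v)) h := by
  have lin (T : EuclideanSpace ℝ (Fin m) →ₗ[ℝ] C(stiefel m, ℂ)) :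
      HasDerivAt (fun h : ℝ => T (x + h • v)) (T v) h := by
    simp only [map_add, map_smul]
    simpa using ((hasDerivAt_id h).smul_const (T v)).const_add (T x)
  have hd := (((lin (tauForm m)).pow k).mul ((lin (daggerForm m)).pow l)).mul_const W
  have hL := ((stiefelMean m).restrictScalars ℝ).hasFDerivAt.comp_hasDerivAt h hd
  refine hL.congr_deriv ?_
  simp only [meanPow, ContinuousLinearMap.coe_restrictScalars']
  have hmul (r : ℕ) (F : C(stiefel m, ℂ)) : (r : ℂ) * stiefelMean m F = stiefelMean m (r * F) := by
    rw [← nsmul_eq_mul, ← map_nsmul, nsmul_eq_mul]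
  rw [hmul, hmul, ← map_add]
  congr 1
  simp only [Pi.pow_apply]
  ring

lemma hasDerivAt_zonal (p i : ℕ) (x v y : EuclideanSpace ℝ (Fin m)) (h : ℝ) :
    HasDerivAt (fun h : ℝ => inner ℝ (x + h • v) y ^ p * (‖x + h • v‖ ^ 2) ^ i)
      (p * inner ℝ v y * (inner ℝ (x + h • v) y ^ (p - 1) * (‖x + h • v‖ ^ 2) ^ i) +
        2 * i * (inner ℝ (x + h • v) v *
          (inner ℝ (x + h • v) y ^ p * (‖x + h • v‖ ^ 2) ^ (i - 1)))) h := by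
  have hx : HasDerivAt (fun h : ℝ => x + h • v) v h := by
    simpa using ((hasDerivAt_id h).smul_const v).const_add x
  have hu : HasDerivAt (fun h : ℝ => inner ℝ (x + h • v) y) (inner ℝ v y) h := by
    simpa using hx.inner ℝ (hasDerivAt_const h y)
  refine ((hu.pow p).mul (hx.norm_sq.pow i)).congr_deriv ?_
  simp only [Pi.pow_apply]
  ring

lemma hasDerivAt_zonal_inner (p i : ℕ) (x v y : EuclideanSpace ℝ (Fin m)) :
    HasDerivAt (fun h : ℝ => p * inner ℝ v y *
        (inner ℝ (x + h • v) y ^ (p - 1) * (‖x + h • v‖ ^ 2) ^ i) +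
        2 * i * (inner ℝ (x + h • v) v *
          (inner ℝ (x + h • v) y ^ p * (‖x + h • v‖ ^ 2) ^ (i - 1))))
      (p * (p - 1 : ℕ) * inner ℝ v y ^ 2 * (inner ℝ x y ^ (p - 2) * (‖x‖ ^ 2) ^ i) +
        4 * p * i * (inner ℝ v y * inner ℝ x v) *
          (inner ℝ x y ^ (p - 1) * (‖x‖ ^ 2) ^ (i - 1)) +
        2 * i * ‖v‖ ^ 2 * (inner ℝ x y ^ p * (‖x‖ ^ 2) ^ (i - 1)) +
        4 * i * (i - 1 : ℕ) * inner ℝ x v ^ 2 * (inner ℝ x y ^ p * (‖x‖ ^ 2) ^ (i - 2))) 0 := by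
  have hx : HasDerivAt (fun h : ℝ => x + h • v) v 0 := by
    simpa using ((hasDerivAt_id (0 : ℝ)).smul_const v).const_add x
  have hv : HasDerivAt (fun h : ℝ => inner ℝ (x + h • v) v) (‖v‖ ^ 2) 0 := by
    simpa using hx.inner ℝ (hasDerivAt_const (0 : ℝ) v)
  refine (((hasDerivAt_zonal (p - 1) i x v y 0).const_mul (p * inner ℝ v y)).add
    ((hv.mul (hasDerivAt_zonal p (i - 1) x v y 0)).const_mul (2 * (i : ℝ)))).congr_deriv ?_
  simp only [zero_smul, add_zero, Nat.sub_sub, Nat.reduceAdd]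
  ring

/-- Second derivatives of the two sides of `exists_meanPow_eq_zonalSum` in a direction `v`. -/
lemma second_deriv_meanPow_eq {k l : ℕ} {W : C(stiefel m, ℂ)} {y : EuclideanSpace ℝ (Fin m)}
    {c : ℕ → ℂ}
    (hc : ∀ x, meanPow k l W x = zonalSum (k + l) c (inner ℝ x y) (‖x‖ ^ 2))
    (x v : EuclideanSpace ℝ (Fin m)) :
    k * ((k - 1 : ℕ) * meanPow (k - 2) l (tauForm m v * tauForm m v * W) x) +
      2 * k * l * meanPow (k - 1) (l - 1) (tauForm m v * daggerForm m v * W) x +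
      l * ((l - 1 : ℕ) * meanPow k (l - 2) (daggerForm m v * daggerForm m v * W) x) =
    ∑ i ∈ Finset.range ((k + l) / 2 + 1), c i *
      (((k + l - 2 * i : ℕ) * (k + l - 2 * i - 1 : ℕ) * inner ℝ v y ^ 2 *
          (inner ℝ x y ^ (k + l - 2 * i - 2) * (‖x‖ ^ 2) ^ i) +
        4 * (k + l - 2 * i : ℕ) * i * (inner ℝ v y * inner ℝ x v) *
          (inner ℝ x y ^ (k + l - 2 * i - 1) * (‖x‖ ^ 2) ^ (i - 1)) +
        2 * i * ‖v‖ ^ 2 * (inner ℝ x y ^ (k + l - 2 * i) * (‖x‖ ^ 2) ^ (i - 1)) +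
        4 * i * (i - 1 : ℕ) * inner ℝ x v ^ 2 *
          (inner ℝ x y ^ (k + l - 2 * i) * (‖x‖ ^ 2) ^ (i - 2)) : ℝ) : ℂ) := by
  -- The first derivatives must agree at every h, not only at 0, in order to be differentiated
  -- again.
  have h1 (h : ℝ) : _ = _ := (hasDerivAt_meanPow k l W x v h).unique
    ((HasDerivAt.fun_sum (u := Finset.range ((k + l) / 2 + 1)) fun i _ =>
      ((hasDerivAt_zonal (k + l - 2 * i) i x v y h).ofReal_comp.const_mul (c i))).congr_of_eventuallyEq
        (.of_forall fun h => hc (x + h • v)))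
  have h2 := ((hasDerivAt_meanPow (k - 1) l (tauForm m v * W) x v 0).const_mul (k : ℂ)).add
    ((hasDerivAt_meanPow k (l - 1) (daggerForm m v * W) x v 0).const_mul (l : ℂ))
  have h3 := HasDerivAt.fun_sum (u := Finset.range ((k + l) / 2 + 1)) fun i _ =>
      ((hasDerivAt_zonal_inner (k + l - 2 * i) i x v y).ofReal_comp.const_mul (c i))
  have h4 := h2.unique (h3.congr_of_eventuallyEq (.of_forall h1))
  rw [← h4]
  simp only [zero_smul, add_zero, Nat.sub_sub, Nat.reduceAdd]
  rw [← mul_assoc (daggerForm m v) (tauForm m v), mul_comm (daggerForm m v) (tauForm m v),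
    mul_assoc (tauForm m v) (tauForm m v), mul_assoc (daggerForm m v) (daggerForm m v),
    mul_assoc (tauForm m v) (daggerForm m v)]
  ring

section Sums

variable (b : OrthonormalBasis (Fin m) ℝ (EuclideanSpace ℝ (Fin m)))

lemma sum_ofReal_inner_mul_inner (x y : EuclideanSpace ℝ (Fin m)) :
    ∑ i, (inner ℝ (b i) x : ℂ) * (inner ℝ (b i) y : ℂ) = (inner ℝ x y : ℂ) := by
  rw [← b.sum_inner_mul_inner x y]
  push_cast
  exact Finset.sum_congr rfl fun i _ => by rw [real_inner_comm x]

/-- Parseval for an orthonormal pair. The value 1 of α or β stands for τ and -1 for τ†, which covers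
all three products at once. -/
lemma sum_forms (p : stiefel m) (α β : ℂ) :
    ∑ i, (α * (inner ℝ (b i) p.1.1 : ℂ) + Complex.I * (inner ℝ (b i) p.1.2 : ℂ)) *
      (β * (inner ℝ (b i) p.1.1 : ℂ) + Complex.I * (inner ℝ (b i) p.1.2 : ℂ)) = α * β - 1 := by
  have h (i : Fin m) :
      (α * (inner ℝ (b i) p.1.1 : ℂ) + Complex.I * (inner ℝ (b i) p.1.2 : ℂ)) *
        (β * (inner ℝ (b i) p.1.1 : ℂ) + Complex.I * (inner ℝ (b i) p.1.2 : ℂ)) =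
      α * β * ((inner ℝ (b i) p.1.1 : ℂ) * (inner ℝ (b i) p.1.1 : ℂ)) +
      (α + β) * Complex.I * ((inner ℝ (b i) p.1.1 : ℂ) * (inner ℝ (b i) p.1.2 : ℂ)) +
      Complex.I ^ 2 * ((inner ℝ (b i) p.1.2 : ℂ) * (inner ℝ (b i) p.1.2 : ℂ)) := by ring
  obtain ⟨⟨t, s⟩, ht, hs, hts⟩ := p
  simp only at ht hs hts
  simp only [h, Finset.sum_add_distrib, ← Finset.mul_sum, sum_ofReal_inner_mul_inner,
    real_inner_self_eq_norm_sq, ht, hs, hts]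
  simp
  ring

lemma sum_tauForm_mul_tauForm : ∑ i, tauForm m (b i) * tauForm m (b i) = 0 := by
  ext p
  simpa [tauForm_apply] using sum_forms b p 1 1

lemma sum_daggerForm_mul_daggerForm : ∑ i, daggerForm m (b i) * daggerForm m (b i) = 0 := by
  ext p
  simpa [daggerForm_apply] using sum_forms b p (-1) (-1)

lemma sum_tauForm_mul_daggerForm :
    ∑ i, tauForm m (b i) * daggerForm m (b i) = (-2 : ℝ) • (1 : C(stiefel m, ℂ)) := by
  ext p
  have := sum_forms b p 1 (-1)
  norm_num at this
  simpa [tauForm_apply, daggerForm_apply] using this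

end Sums

/-- The Laplacian of the two sides of `exists_meanPow_eq_zonalSum`. -/
lemma laplacian_meanPow_eq {k l : ℕ} {W : C(stiefel m, ℂ)} {y : EuclideanSpace ℝ (Fin m)}
    (hy : ‖y‖ = 1) {c : ℕ → ℂ}
    (hc : ∀ x, meanPow k l W x = zonalSum (k + l) c (inner ℝ x y) (‖x‖ ^ 2))
    (x : EuclideanSpace ℝ (Fin m)) (hx : inner ℝ x y = 1) :
    -4 * k * l * meanPow (k - 1) (l - 1) W x =
    ∑ i ∈ Finset.range ((k + l) / 2 + 1), c i *
      (((k + l - 2 * i : ℕ) * (k + l - 2 * i - 1 : ℕ) * (‖x‖ ^ 2) ^ i +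
        2 * i * (2 * (k + l - 2 * i : ℕ) + m + 2 * (i - 1 : ℕ)) * (‖x‖ ^ 2) ^ (i - 1) : ℝ) : ℂ) := by
  have b := EuclideanSpace.basisFun (Fin m) ℝ
  have h := Finset.sum_congr (rfl : Finset.univ = Finset.univ)
    fun j _ => second_deriv_meanPow_eq hc x (b j)
  -- Summed over the basis, the two pure terms vanish because τ and τ† are isotropic; the mixed one
  -- yields the factor -2.
  simp only [Finset.sum_add_distrib, ← Finset.mul_sum, meanPow_sum, ← Finset.sum_mul,
    sum_tauForm_mul_tauForm, sum_tauForm_mul_daggerForm, sum_daggerForm_mul_daggerForm, zero_mul,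
    meanPow_zero, mul_zero, zero_add, add_zero, smul_mul_assoc, one_mul, meanPow_const_mul] at h
  rw [Finset.sum_comm] at h
  calc _ = 2 * k * l * (((-2 : ℝ) : ℂ) * meanPow (k - 1) (l - 1) W x) := by push_cast; ring
    _ = _ := by
      rw [h]
      refine Finset.sum_congr rfl fun i _ => ?_
      rw [← Finset.mul_sum, ← Complex.ofReal_sum]
      congr 2
      have s1 : ∑ j, inner ℝ (b j) y ^ 2 = 1 := by
        have h := b.sum_inner_mul_inner y y
        rw [real_inner_self_eq_norm_sq, hy, one_pow] at h
        exact Eq.trans (Finset.sum_congr rfl fun j _ => by rw [real_inner_comm y, sq]) h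
      have s2 : ∑ j, inner ℝ (b j) y * inner ℝ x (b j) = 1 := by
        rw [← hx, ← b.sum_inner_mul_inner x y]
        exact Finset.sum_congr rfl fun j _ => mul_comm _ _
      have s3 : ∑ j, inner ℝ x (b j) ^ 2 = ‖x‖ ^ 2 := by
        rw [← real_inner_self_eq_norm_sq, ← b.sum_inner_mul_inner x x]
        exact Finset.sum_congr rfl fun j _ => by rw [real_inner_comm x, sq]
      simp only [hx, one_pow, one_mul, Finset.sum_add_distrib, ← Finset.mul_sum, ← Finset.sum_mul,
        s1, s2, s3, b.norm_eq_one, Finset.sum_const, Finset.card_univ, Fintype.card_fin,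
        nsmul_eq_mul]
      -- The truncated exponents i - 1 and i - 2 make i = 0 and i = 1 separate cases.
      obtain _ | _ | i := i
      · simp
      · simp
        ring
      · simp
        ring

/-! ### The Laplacian on coefficients -/

lemma eq_zero_of_sum_pow_eq_zero {N : ℕ} {f : ℕ → ℂ}
    (h : ∀ q : ℝ, 1 ≤ q → ∑ i ∈ Finset.range N, f i * ((q ^ i : ℝ) : ℂ) = 0) {i : ℕ}
    (hi : i < N) : f i = 0 := by
  set P : Polynomial ℂ := ∑ i ∈ Finset.range N, Polynomial.monomial i (f i) with hP
  have hP0 : P = 0 := by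
    refine Polynomial.eq_zero_of_infinite_isRoot P (Set.Infinite.mono ?_
      ((Set.Ici_infinite (1 : ℝ)).image Complex.ofReal_injective.injOn))
    rintro _ ⟨q, hq, rfl⟩
    simpa [hP, Polynomial.eval_finsetSum] using h q hq
  have := congrArg (Polynomial.coeff · i) hP0
  simpa [hP, Polynomial.finsetSum_coeff, Polynomial.coeff_monomial, hi] using this

lemma sum_range_add_shift (f g : ℕ → ℂ) {N : ℕ} (hf : f (N + 1) = 0) (hg : g 0 = 0) :
    ∑ i ∈ Finset.range (N + 1 + 1), (f i + g i) =
      ∑ i ∈ Finset.range (N + 1), (f i + g (i + 1)) := by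
  rw [Finset.sum_add_distrib, Finset.sum_range_succ f, Finset.sum_range_succ' g, hf, hg, add_zero,
    add_zero, Finset.sum_add_distrib]

/-- The action of the Laplacian on the coefficients of a zonal polynomial of degree `n`. -/
def zonalLaplacian (m n : ℕ) (c : ℕ → ℂ) (i : ℕ) : ℂ :=
  (n - 2 * i) * (n - 2 * i - 1) * c i + 2 * (i + 1) * (2 * n - 2 * i - 4 + m) * c (i + 1)

/-- By homogeneity it is enough to compare on the hyperplane ⟨x,y⟩ = 1, where e + √(q-1) f realizes
every q ≥ 1. The factor kl in `hc'` admits c' = 0 when l = 0. -/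
lemma zonalLaplacian_eq (hm : 2 ≤ m) {k l a b : ℕ} (hkl : 2 ≤ k + l) {c c' : ℕ → ℂ}
    (hc : ∀ x y : EuclideanSpace ℝ (Fin m), ‖y‖ = 1 →
      meanPow k l (weight a b y) x = zonalSum (k + l) c (inner ℝ x y) (‖x‖ ^ 2))
    (hc' : ∀ x y : EuclideanSpace ℝ (Fin m), ‖y‖ = 1 →
      k * l * meanPow (k - 1) (l - 1) (weight a b y) x =
        k * l * zonalSum (k + l - 2) c' (inner ℝ x y) (‖x‖ ^ 2))
    {i : ℕ} (hi : 2 * i + 2 ≤ k + l) :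
    zonalLaplacian m (k + l) c i = -4 * k * l * c' i := by
  rw [← sub_eq_zero]
  refine eq_zero_of_sum_pow_eq_zero (N := (k + l - 2) / 2 + 1)
    (f := fun i => zonalLaplacian m (k + l) c i - -4 * k * l * c' i) (fun q hq => ?_) (by omega)
  set e : EuclideanSpace ℝ (Fin m) := EuclideanSpace.single ⟨0, by omega⟩ 1 with he_def
  set f : EuclideanSpace ℝ (Fin m) := EuclideanSpace.single ⟨1, by omega⟩ 1 with hf_def
  have he : ‖e‖ = 1 := by simp [he_def]
  have hf : ‖f‖ = 1 := by simp [hf_def]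
  have hef : inner ℝ e f = 0 := by simp [he_def, hf_def, EuclideanSpace.inner_single_left]
  have hxe : inner ℝ (e + √(q - 1) • f) e = 1 := by
    rw [inner_add_left, real_inner_smul_left, real_inner_comm e f, hef, real_inner_self_eq_norm_sq, he]
    simp
  have hxn : ‖e + √(q - 1) • f‖ ^ 2 = q := by
    rw [norm_add_sq_real, real_inner_smul_right, hef, norm_smul, he, hf, Real.norm_eq_abs,
      abs_of_nonneg (Real.sqrt_nonneg _), mul_one, Real.sq_sqrt (by linarith)]
    ring
  have h := laplacian_meanPow_eq he (fun x => hc x e he) _ hxe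
  have h' := hc' (e + √(q - 1) • f) e he
  rw [hxe, hxn] at h'
  rw [hxn] at h
  replace h : -4 * (k * l * meanPow (k - 1) (l - 1) (weight a b e) (e + √(q - 1) • f)) = _ :=
    (by ring : _ = _).trans h
  rw [h', zonalSum] at h
  simp only [sub_mul, Finset.sum_sub_distrib, sub_eq_zero]
  have hN : (k + l) / 2 + 1 = (k + l - 2) / 2 + 1 + 1 := by omega
  -- At the top index the exponent of u is 0 or 1, so its second derivative vanishes. Together with
  -- the factor i at i = 0, this allows the index shift.
  have htop : ((k + l - 2 * ((k + l - 2) / 2 + 1) : ℕ) : ℝ) *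
      ((k + l - 2 * ((k + l - 2) / 2 + 1) - 1 : ℕ) : ℝ) = 0 := by
    rw [← Nat.cast_mul, Nat.cast_eq_zero, mul_eq_zero]
    omega
  simp only [Complex.ofReal_add, mul_add (c _)] at h
  rw [hN, sum_range_add_shift _ _ (by rw [htop, zero_mul, Complex.ofReal_zero, mul_zero])
    (by simp)] at h
  refine Eq.trans ?_ (h.symm.trans ?_)
  · refine Finset.sum_congr rfl fun i hi => ?_
    have hi : 2 * i + 2 ≤ k + l := by
      rw [Finset.mem_range] at hi
      omega
    obtain ⟨d, hd⟩ := Nat.exists_eq_add_of_le hi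
    have e1 : k + l - 2 * i = d + 2 := by omega
    have e2 : k + l - 2 * (i + 1) = d := by omega
    have e3 : (k : ℂ) + l = 2 * i + 2 + d := by exact_mod_cast hd
    rw [zonalLaplacian, e1, e2, Nat.add_sub_cancel, show d + 2 - 1 = d + 1 from rfl]
    push_cast
    rw [e3]
    ring
  · rw [Finset.mul_sum, Finset.mul_sum]
    exact Finset.sum_congr rfl fun i _ => by rw [one_pow, one_mul]; ring

/-! ### Gegenbauer polynomials and their multiples by powers of |x|² -/

/-- The coefficient of `u^{r-2i} q^i` in `q^{r/2} C_r^{m/2-1}(u / √q)`. -/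
def gegenbauerCoeff (m r i : ℕ) : ℝ :=
  (-1) ^ i * (ascPochhammer ℝ (r - i)).eval ((m : ℝ) / 2 - 1) /
    ((i.factorial : ℝ) * ((r - 2 * i).factorial : ℝ)) * 2 ^ (r - 2 * i)

lemma gegenbauerCoeff_zero_ne_zero (hm : 3 ≤ m) (r : ℕ) : gegenbauerCoeff m r 0 ≠ 0 := by
  have hm' : (3 : ℝ) ≤ m := by exact_mod_cast hm
  have := ascPochhammer_pos r ((m : ℝ) / 2 - 1) (by linarith)
  rw [gegenbauerCoeff]
  simp only [Nat.sub_zero, mul_zero]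
  positivity

/-- Harmonicity of the homogenized Gegenbauer polynomial, read off coefficientwise. It reduces to
(a)_{s+1} = (a)_s (a + s). -/
lemma gegenbauerCoeff_rec {r i : ℕ} (h : 2 * i + 2 ≤ r) :
    ((r : ℝ) - 2 * i) * (r - 2 * i - 1) * gegenbauerCoeff m r i +
      2 * (i + 1) * (2 * r - 2 * i - 4 + m) * gegenbauerCoeff m r (i + 1) = 0 := by
  obtain ⟨d, rfl⟩ := Nat.exists_eq_add_of_le h
  have e1 : 2 * i + 2 + d - i = i + d + 1 + 1 := by omega
  have e2 : 2 * i + 2 + d - 2 * i = d + 2 := by omega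
  have e3 : 2 * i + 2 + d - (i + 1) = i + d + 1 := by omega
  have e4 : 2 * i + 2 + d - 2 * (i + 1) = d := by omega
  rw [gegenbauerCoeff, gegenbauerCoeff, e1, e2, e3, e4, ascPochhammer_succ_eval,
    Nat.factorial_succ (d + 1), Nat.factorial_succ d, Nat.factorial_succ i]
  push_cast
  field_simp
  ring

/-- The coefficients of `q^j` times the Gegenbauer polynomial of degree `r`. -/
def shiftedCoeff (m r j i : ℕ) : ℂ :=
  if j ≤ i then (gegenbauerCoeff m r (i - j) : ℂ) else 0

lemma zonalLaplacian_shiftedCoeff_zero {n i : ℕ} (h : 2 * i + 2 ≤ n) :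
    zonalLaplacian m n (shiftedCoeff m n 0) i = 0 := by
  simp only [zonalLaplacian, shiftedCoeff, zero_le, if_true, Nat.sub_zero]
  exact_mod_cast gegenbauerCoeff_rec (m := m) h

/-- Coefficient form of Δ(|x|^{2j+2} H) = 2(j+1)(2r+2j+m) |x|^{2j} H for H harmonic of degree r.
Below i = j everything vanishes, at i = j one term survives, and above it the difference is the
harmonic recurrence. -/
lemma zonalLaplacian_shiftedCoeff_succ {r j i : ℕ} (h : 2 * i + 2 ≤ r + 2 * (j + 1)) :
    zonalLaplacian m (r + 2 * (j + 1)) (shiftedCoeff m r (j + 1)) i =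
      2 * (j + 1) * (2 * r + 2 * j + m) * shiftedCoeff m r j i := by
  rcases lt_trichotomy i j with hij | rfl | hij
  · simp [zonalLaplacian, shiftedCoeff, hij.not_ge, show ¬ j + 1 ≤ i by omega]
  · simp only [zonalLaplacian, shiftedCoeff, show ¬ i + 1 ≤ i by omega, le_refl, if_true, if_false,
      Nat.sub_self]
    push_cast
    ring
  · obtain ⟨s, rfl⟩ := Nat.exists_eq_add_of_le (Nat.succ_le_of_lt hij)
    have hrec := gegenbauerCoeff_rec (m := m) (r := r) (i := s) (by omega)
    have hrec' : ((r : ℂ) - 2 * s) * (r - 2 * s - 1) * gegenbauerCoeff m r s +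
      2 * (s + 1) * (2 * r - 2 * s - 4 + m) * gegenbauerCoeff m r (s + 1) = 0 := by
      exact_mod_cast hrec
    simp only [zonalLaplacian, shiftedCoeff, show j + 1 ≤ j.succ + s by omega,
      show j + 1 ≤ j.succ + s + 1 by omega, show j ≤ j.succ + s by omega, if_true,
      show j.succ + s - (j + 1) = s by omega, show j.succ + s + 1 - (j + 1) = s + 1 by omega,
      show j.succ + s - j = s + 1 by omega]
    push_cast
    linear_combination hrec'

lemma zonalLaplacian_sum (n N : ℕ) (d : ℕ → ℂ) (s : ℕ → ℕ → ℂ) (i : ℕ) :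
    zonalLaplacian m n (fun i => ∑ j ∈ Finset.range N, d j * s j i) i =
      ∑ j ∈ Finset.range N, d j * zonalLaplacian m n (s j) i := by
  simp only [zonalLaplacian, Finset.mul_sum, ← Finset.sum_add_distrib]
  exact Finset.sum_congr rfl fun j _ => by ring

/-- The Laplacian is a two-term recurrence that can be solved for c (i + 1): its factor
2(i+1)(2n-2i-4+m) is positive when 2(i+1) ≤ n. -/
lemma eq_of_zonalLaplacian_eq (hm : 3 ≤ m) {n : ℕ} {c c' : ℕ → ℂ} (h0 : c 0 = c' 0)
    (h : ∀ i, 2 * i + 2 ≤ n → zonalLaplacian m n c i = zonalLaplacian m n c' i)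
    (i : ℕ) (hi : 2 * i ≤ n) : c i = c' i := by
  induction i with
  | zero => exact h0
  | succ i ih =>
    have hne : (2 * (i + 1) * (2 * n - 2 * i - 4 + m) : ℂ) ≠ 0 := by
      obtain ⟨d, rfl⟩ := Nat.exists_eq_add_of_le hi
      obtain ⟨s, rfl⟩ := Nat.exists_eq_add_of_le hm
      have : (2 * (i + 1) * (2 * (2 * (i + 1) + d : ℕ) - 2 * i - 4 + (3 + s : ℕ)) : ℂ) =
        (2 * (i + 1) * (2 * i + 2 * d + 3 + s) : ℕ) := by
        push_cast
        ring
      rw [this, Nat.cast_ne_zero]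
      positivity
    have := h i (by omega)
    rw [zonalLaplacian, zonalLaplacian, ih (by omega), add_right_inj] at this
    exact mul_left_cancel₀ hne this

/-! ### Induction on l -/

/-- Only the first `l + 1` terms of the harmonic decomposition occur, as the integrand is killed by
the `l + 1`-st power of the Laplacian. -/
lemma exists_meanPow_eq_sum_shiftedCoeff (hm : 3 ≤ m) (a b l : ℕ) : ∀ k, l ≤ k → ∃ d : ℕ → ℂ,
    ∀ x y : EuclideanSpace ℝ (Fin m), ‖y‖ = 1 →
      meanPow k l (weight a b y) x = zonalSum (k + l)
        (fun i => ∑ j ∈ Finset.range (l + 1), d j * shiftedCoeff m (k + l - 2 * j) j i)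
        (inner ℝ x y) (‖x‖ ^ 2) := by
  have hg (n : ℕ) : shiftedCoeff m n 0 0 ≠ 0 := by
    simpa [shiftedCoeff] using gegenbauerCoeff_zero_ne_zero hm n
  have zonalSum_congr {n : ℕ} {c c' : ℕ → ℂ} (h : ∀ i, 2 * i ≤ n → c i = c' i) (u q : ℝ) :
      zonalSum n c u q = zonalSum n c' u q :=
    Finset.sum_congr rfl fun i hi => by
      rw [h i (by rw [Finset.mem_range] at hi; omega)]
  induction l with
  | zero =>
    intro k _
    obtain ⟨c, hc⟩ := exists_meanPow_eq_zonalSum (m := m) (by omega) k 0 a b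
    -- For l = 0 the mean is harmonic, hence a multiple of the Gegenbauer polynomial, fixed by the
    -- coefficient of u^k.
    refine ⟨fun _ => c 0 / shiftedCoeff m k 0 0, fun x y hy => (hc x y hy).trans ?_⟩
    refine zonalSum_congr (eq_of_zonalLaplacian_eq hm ?_ fun i hi => ?_) _ _
    · simp [div_mul_cancel₀ _ (hg k)]
    · rw [zonalLaplacian_eq (by omega) (by omega) hc (c' := 0) (by simp) hi, zonalLaplacian_sum]
      simpa using Or.inr (zonalLaplacian_shiftedCoeff_zero hi)
  | succ l ih =>
    intro k hk
    obtain ⟨k, rfl⟩ := Nat.exists_eq_add_of_le' (show 1 ≤ k by omega)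
    obtain ⟨d, hd⟩ := ih k (by omega)
    obtain ⟨c, hc⟩ := exists_meanPow_eq_zonalSum (m := m) (by omega) (k + 1) (l + 1) a b
    -- Terms with j ≥ 1 have no u^n coefficient, so d' 0 alone matches c 0. The others invert the
    -- Laplacian on |x|^{2j+2} H, applied to -4(k+1)(l+1) times the previous decomposition.
    set d' : ℕ → ℂ := fun j => match j with
      | 0 => c 0 / shiftedCoeff m (k + 1 + (l + 1)) 0 0
      | j + 1 => -4 * (k + 1) * (l + 1) * d j /
          (2 * (j + 1) * (2 * (k + l - 2 * j : ℕ) + 2 * j + m)) with hd'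
    refine ⟨d', fun x y hy => (hc x y hy).trans ?_⟩
    refine zonalSum_congr (eq_of_zonalLaplacian_eq hm ?_ fun i hi => ?_) _ _
    · rw [Finset.sum_range_succ', Finset.sum_eq_zero]
      · simp [hd', div_mul_cancel₀ _ (hg _)]
      · intro j _
        simp [shiftedCoeff]
    · rw [zonalLaplacian_eq (by omega) (by omega) hc
        (c' := fun i => ∑ j ∈ Finset.range (l + 1), d j * shiftedCoeff m (k + l - 2 * j) j i)
        (fun x y hy => by
          rw [Nat.add_sub_cancel, Nat.add_sub_cancel, hd x y hy,
            show k + 1 + (l + 1) - 2 = k + l by omega]) hi,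
        zonalLaplacian_sum, Finset.sum_range_succ' _ (l + 1), mul_zero, Nat.sub_zero,
        zonalLaplacian_shiftedCoeff_zero hi, mul_zero, add_zero, Finset.mul_sum]
      refine Finset.sum_congr rfl fun j hj => ?_
      have hj : j ≤ l := Nat.lt_succ_iff.mp (Finset.mem_range.mp hj)
      have hr : k + 1 + (l + 1) - 2 * (j + 1) = k + l - 2 * j := by omega
      have hn : k + 1 + (l + 1) = k + l - 2 * j + 2 * (j + 1) := by omega
      rw [hr, hn, zonalLaplacian_shiftedCoeff_succ (by omega)]
      have hne : (2 * (j + 1) * (2 * (k + l - 2 * j : ℕ) + 2 * j + m) : ℂ) ≠ 0 := by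
        norm_cast
        have : 0 < m := by omega
        positivity
      simp only [hd']
      rw [← mul_assoc (_ / _), div_mul_cancel₀ _ hne]
      push_cast
      ring

/-! ### Return to zonal harmonics and to arbitrary y -/

lemma gegenbauer_homogeneous (m r : ℕ) (x y : EuclideanSpace ℝ (Fin m)) :
    ‖x‖ ^ r * ‖y‖ ^ r * gegenbauer r ((m : ℝ) / 2 - 1) (inner ℝ x y / (‖x‖ * ‖y‖)) =
      ∑ i ∈ Finset.range (r / 2 + 1), gegenbauerCoeff m r i *
        (inner ℝ x y ^ (r - 2 * i) * (‖x‖ ^ 2 * ‖y‖ ^ 2) ^ i) := by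
  rw [gegenbauer, Finset.mul_sum]
  refine Finset.sum_congr rfl fun i hi => ?_
  obtain ⟨d, hd⟩ := Nat.exists_eq_add_of_le (show 2 * i ≤ r by
    rw [Finset.mem_range] at hi
    omega)
  have hd' : r - 2 * i = d := by omega
  have h : (‖x‖ * ‖y‖) ^ d * (inner ℝ x y / (‖x‖ * ‖y‖)) ^ d = inner ℝ x y ^ d := by
    rw [← mul_pow]
    -- If x or y is 0, the quotient is 0 by convention and both sides are 0^d.
    rcases eq_or_ne x 0 with rfl | hx
    · simp
    rcases eq_or_ne y 0 with rfl | hy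
    · simp
    rw [mul_div_cancel₀ _ (by positivity)]
  rw [gegenbauerCoeff, hd', ← h, hd, pow_add, pow_add, mul_pow 2, pow_mul, pow_mul, mul_pow, mul_pow]
  ring

/-- Here ρ stands for |y|: the factor ρ^n is shared out so that u becomes ρu and q becomes qρ² in
the Gegenbauer part, leaving ρ^{2j} outside. -/
lemma zonalSum_shiftedCoeff {n j : ℕ} (hj : 2 * j ≤ n) (u q ρ : ℝ) :
    (ρ : ℂ) ^ n * zonalSum n (shiftedCoeff m (n - 2 * j) j) u q =
      ((q ^ j * ρ ^ (2 * j) * ∑ i ∈ Finset.range ((n - 2 * j) / 2 + 1),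
        gegenbauerCoeff m (n - 2 * j) i *
          ((ρ * u) ^ (n - 2 * j - 2 * i) * (q * ρ ^ 2) ^ i) : ℝ) : ℂ) := by
  have hN : n / 2 + 1 = j + ((n - 2 * j) / 2 + 1) := by omega
  rw [zonalSum, hN, Finset.sum_range_add, Finset.sum_eq_zero, zero_add, Finset.mul_sum,
    Finset.mul_sum, Complex.ofReal_sum]
  · refine Finset.sum_congr rfl fun i hi => ?_
    obtain ⟨d, hd⟩ := Nat.exists_eq_add_of_le (show 2 * (j + i) ≤ n by
      rw [Finset.mem_range] at hi
      omega)
    have h1 : n - 2 * (j + i) = d := by omega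
    have h2 : n - 2 * j - 2 * i = d := by omega
    rw [shiftedCoeff, if_pos (Nat.le_add_right j i), Nat.add_sub_cancel_left, h1, h2]
    rw [show (ρ : ℂ) ^ n = (ρ : ℂ) ^ (2 * (j + i) + d) by rw [← hd]]
    push_cast
    ring
  · intro i hi
    rw [shiftedCoeff, if_neg (by simpa using hi), zero_mul]

end

theorem mainTheorem5 (m : ℕ) (hm : 3 ≤ m) :
    ∃ θ : ℕ → ℕ → ℕ → ℂ, ∀ k l : ℕ, l ≤ k → ∀ x y : EuclideanSpace ℝ (Fin m),
      StiefelConverges (stiefelIntegrand k l x y) ∧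
      stiefelAverage (stiefelIntegrand k l x y) =
        ∑ j ∈ Finset.range (l + 1),
          θ j k l * (‖x‖ : ℂ) ^ (2 * j) * (zonalHarmonic m (k + l - 2 * j) x y : ℂ) *
            (‖y‖ : ℂ) ^ (2 * j) := by
  choose d hd using fun k l => exists_meanPow_eq_sum_shiftedCoeff hm l k l k
  -- The quotient (m-2)/(2r+m-2), with r = k+l-2j, cancels the normalization of K_{m,r}. The
  -- constants d exist only for l ≤ k, hence the default 0.
  refine ⟨fun j k l => if h : l ≤ k then
    d k l h j * (((m : ℝ) - 2) / (2 * (k + l - 2 * j : ℕ) + (m : ℝ) - 2) : ℝ) else 0,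
    fun k l hkl x y => ?_⟩
  obtain ⟨hconv, havg⟩ := stiefelAverage_eq (stiefelIntegrand k l x y)
    (tauForm m x ^ k * daggerForm m x ^ l * weight l k y) fun p => by
      simp only [stiefelIntegrand, bilin_complexify_tauVec, bilin_complexify_dagger_tauVec, weight,
        ContinuousMap.mul_apply, ContinuousMap.pow_apply, tauForm_apply, daggerForm_apply]
      ring
  refine ⟨hconv, ?_⟩
  -- A unit direction of y; for y = 0 any unit vector serves.
  obtain ⟨e, he, hye⟩ : ∃ e : EuclideanSpace ℝ (Fin m), ‖e‖ = 1 ∧ y = ‖y‖ • e := by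
    rcases eq_or_ne y 0 with rfl | hy
    · exact ⟨EuclideanSpace.single ⟨0, by omega⟩ 1, by simp, by simp⟩
    · exact ⟨‖y‖⁻¹ • y, by simp [norm_smul, hy], by simp [smul_smul, hy]⟩
  have hweight : weight l k y = ‖y‖ ^ (k + l) • weight l k e := by
    conv_lhs => rw [hye]
    rw [weight, map_smul, map_smul, smul_pow, smul_pow, smul_mul_smul_comm, ← pow_add, add_comm k,
      weight]
  have hinner : inner ℝ x y = ‖y‖ * inner ℝ x e := by
    conv_lhs => rw [hye, real_inner_smul_right]
  have hsum : zonalSum (k + l)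
      (fun i => ∑ j ∈ Finset.range (l + 1), d k l hkl j * shiftedCoeff m (k + l - 2 * j) j i)
      (inner ℝ x e) (‖x‖ ^ 2) = ∑ j ∈ Finset.range (l + 1), d k l hkl j *
        zonalSum (k + l) (shiftedCoeff m (k + l - 2 * j) j) (inner ℝ x e) (‖x‖ ^ 2) := by
    simp only [zonalSum, Finset.sum_mul, Finset.mul_sum]
    rw [Finset.sum_comm]
    exact Finset.sum_congr rfl fun j _ => Finset.sum_congr rfl fun i _ => by ring
  rw [havg, hweight, mul_smul_comm, stiefelMean_real_smul, ← meanPow, hd k l hkl x e he, hsum,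
    Finset.mul_sum]
  refine Finset.sum_congr rfl fun j hj => ?_
  have hj : 2 * j ≤ k + l := by
    rw [Finset.mem_range] at hj
    omega
  have hm' : (3 : ℝ) ≤ m := by exact_mod_cast hm
  have h1 : (m : ℝ) - 2 ≠ 0 := by linarith
  have h2 : 2 * ((k + l - 2 * j : ℕ) : ℝ) + m - 2 ≠ 0 := by
    have : (0 : ℝ) ≤ ((k + l - 2 * j : ℕ) : ℝ) := Nat.cast_nonneg _
    linarith
  rw [mul_left_comm, Complex.ofReal_pow, zonalSum_shiftedCoeff hj, ← hinner,
    ← gegenbauer_homogeneous]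
  beta_reduce
  rw [dif_pos hkl, zonalHarmonic, mul_assoc (d k l hkl j),
    mul_assoc (d k l hkl j), mul_assoc (d k l hkl j)]
  congr 1
  rw [← Complex.ofReal_pow, ← Complex.ofReal_pow, ← Complex.ofReal_mul, ← Complex.ofReal_mul,
    ← Complex.ofReal_mul, Complex.ofReal_inj]
  field_simp
  ring
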